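/- Let $n\ge 1$ and let $\mathbb F_n^+$ be the free semigroup of words in $g_1,\dots,g_n$, with empty word $g_0$ and length $|\cdot|$. For operators $X_1,\dots,X_n$ on a Hilbert space and $\alpha=g_{i_1}\cdots g_{i_k}$ put $X_\alpha=X_{i_1}\cdots X_{i_k}$, $X_{g_0}=I$. Let $f=\sum_{|\alpha|\ge1}a_\alpha X_\alpha$ be a positive regular free holomorphic function: $a_\alpha\ge 0$ for all $\alpha$, $a_{g_0}=0$, $a_{g_i}>0$ for $i=1,\dots,n$, and $\limsup_{k\to\infty}\big(\sum_{|\alpha|=k}|a_\alpha|^2\big)^{1/2k}<\infty$. Set $b_{g_0}=1$ and $$b_\alpha=\sum_{j=1}^{|\alpha|}\ \sum_{\gamma_1\cdots\gamma_j=\alpha,\ |\gamma_1|,\dots,|\gamma_j|\ge1}a_{\gamma_1}\cdots a_{\gamma_j}\qquad(|\alpha|\ge1).$$ For a complex Hilbert space $\mathcal H$ let $\mathcal D_f(\mathcal H)$ be the set of all $n$-tuples $T=(T_1,\dots,T_n)\in B(\mathcal H)^n$ such that the series $\Phi_{f,T}(I):=\sum_{|\alpha|\ge1}a_\alpha T_\alpha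 T_\alpha^*$ converges in the weak operator topology and $\|\Phi_{f,T}(I)\|\le1$; put $\Delta_{f,T}=(I-\Phi_{f,T}(I))^{1/2}$. On the full Fock space $F^2(H_n)$ with orthonormal basis $(e_\alpha)_{\alpha\in\mathbb F_n^+}$ let $W_1,\dots,W_n$ be the weighted left creation operators $W_ie_\alpha=\sqrt{b_\alpha/b_{g_i\alpha}}\;e_{g_i\alpha}$. Let $T\in\mathcal D_f(\mathcal H)$. Then: (a) For every $0\le r<1$, $rT=(rT_1,\dots,rT_n)$ belongs to $\mathcal D_f(\mathcal H)$ and $$K_{f,rT}h=\sum_{\alpha\in\mathbb F_n^+}\sqrt{b_\alpha}\;e_\alpha\otimes\Delta_{f,rT}(rT)_\alpha^*h\qquad(h\in\mathcal H)$$ converges in norm and defines a bounded operator $K_{f,rT}:\mathcal H\to F^2(H_n)\otimes\mathcal H$ (Hilbert space tensor product). (b) There is a unital completely contractive linear map $\Psi_{f,T}:\overline{\operatorname{span}}\{W_\alpha W_\beta^*:\alpha,\beta\in\mathbb F_n^+\}\to B(\mathcal H)$ (norm closure) such that $\Psi_{f,T}(W_\alpha W_\beta^*)=T_\alpha T_\beta^*$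 for all $\alpha,\beta\in\mathbb F_n^+$, and $$\Psi_{f,T}(g)=\lim_{r\to1^-}K_{f,rT}^*(g\otimes I_{\mathcal H})K_{f,rT}$$ in the norm of $B(\mathcal H)$ for every $g$ in this closed span. (c) (von Neumann inequality) For every finitely supported family of complex numbers $(c_{\alpha,\beta})$, $$\Big\|\sum_{\alpha,\beta}c_{\alpha,\beta}T_\alpha T_\beta^*\Big\|\le\Big\|\sum_{\alpha,\beta}c_{\alpha,\beta}W_\alpha W_\beta^*\Big\|;$$ in particular $\|q(T_1,\dots,T_n)\|\le\|q(W_1,\dots,W_n)\|$ for every polynomial $q$ in $n$ noncommuting indeterminates. -/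

import Mathlib

open Filter Topology
open scoped TensorProduct InnerProductSpace

noncomputable section

namespace NCDomain

/-! ## Fock space and Hilbert tensor products -/

/-- Words in the generators `g₁, …, gₙ`: the unital free semigroup on `n` generators. -/
abbrev Word (n : ℕ) : Type := FreeMonoid (Fin n)

/-- The full Fock space on `n` generators, realised as the Hilbert space `ℓ²` of the set of words;
the basis vector `e_α` is `e_{i₁} ⊗ ⋯ ⊗ e_{iₖ}` for the word `α = g_{i₁} ⋯ g_{iₖ}`. -/
abbrev Fock (n : ℕ) : Type := lp (fun _ : Word n => ℂ) 2

/-- The canonical orthonormal basis `(e_α)` of the full Fock space. -/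
def fockBasis (n : ℕ) : HilbertBasis (Word n) ℂ (Fock n) :=
  HilbertBasis.ofRepr (LinearIsometryEquiv.refl ℂ (Fock n))

/-- The Hilbert space tensor product: the completion of the algebraic tensor product for the
inner product `⟪x ⊗ y, x' ⊗ y'⟫ = ⟪x, x'⟫ ⟪y, y'⟫`. -/
abbrev HTensor (E F : Type*) [NormedAddCommGroup E] [InnerProductSpace ℂ E]
    [NormedAddCommGroup F] [InnerProductSpace ℂ F] : Type _ :=
  UniformSpace.Completion (E ⊗[ℂ] F)

section Ampliation

variable {E : Type*} [NormedAddCommGroup E] [InnerProductSpace ℂ E]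
  (F : Type*) [NormedAddCommGroup F] [InnerProductSpace ℂ F]

/-- The operator `g ⊗ I_F` on the Hilbert tensor product `E ⊗ F`. -/
def ampliation (g : E →L[ℂ] E) : HTensor E F →L[ℂ] HTensor E F :=
  ((UniformSpace.Completion.toComplL : (E ⊗[ℂ] F) →L[ℂ] HTensor E F).comp
    (g.rTensor F)).extend (UniformSpace.Completion.toComplL : (E ⊗[ℂ] F) →L[ℂ] HTensor E F)

theorem ampliation_coe (g : E →L[ℂ] E) (x : E ⊗[ℂ] F) :
    ampliation F g (x : HTensor E F) = ((g.rTensor F x : E ⊗[ℂ] F) : HTensor E F) := by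
  have h := ContinuousLinearMap.extend_eq
    ((UniformSpace.Completion.toComplL : (E ⊗[ℂ] F) →L[ℂ] HTensor E F).comp (g.rTensor F))
    (e := (UniformSpace.Completion.toComplL : (E ⊗[ℂ] F) →L[ℂ] HTensor E F))
    UniformSpace.Completion.denseRange_coe
    (UniformSpace.Completion.isUniformInducing_coe _) x
  exact h

end Ampliation

/-! ## Matrices of operators and complete contractivity -/

/-- The product `T_α = T_{i₁} ⋯ T_{iₖ}` for `α = g_{i₁} ⋯ g_{iₖ}`, with `T_α = I` for the
empty word. -/
def opWord {n : ℕ} {H : Type*} [NormedAddCommGroup H] [InnerProductSpace ℂ H]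
    (T : Fin n → H →L[ℂ] H) (α : Word n) : H →L[ℂ] H :=
  FreeMonoid.lift T α

/-- The operator on the `m`-fold Hilbert direct sum `H⁽ᵐ⁾` given by an `m × m` matrix of operators
on `H`: its `i`-th component at `x` is `∑ j, A i j (x j)`. -/
def opMatrix {m : ℕ} {H : Type*} [NormedAddCommGroup H] [InnerProductSpace ℂ H]
    (A : Matrix (Fin m) (Fin m) (H →L[ℂ] H)) :
    PiLp 2 (fun _ : Fin m => H) →L[ℂ] PiLp 2 (fun _ : Fin m => H) :=
  ((PiLp.continuousLinearEquiv 2 ℂ (fun _ : Fin m => H)).symm :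
      (Fin m → H) →L[ℂ] PiLp 2 (fun _ : Fin m => H)).comp
    (ContinuousLinearMap.pi fun i => ∑ j, (A i j).comp (PiLp.proj 2 (fun _ : Fin m => H) j))

/-- A linear map `u` from a space `S` of operators on `E` to `B(H)` is completely contractive if
`‖[u(x_{ij})]‖ ≤ ‖[x_{ij}]‖` for all `m × m` matrices with entries in `S` and all `m`. -/
def IsCompletelyContractive {E H : Type*} [NormedAddCommGroup E] [InnerProductSpace ℂ E]
    [NormedAddCommGroup H] [InnerProductSpace ℂ H] (S : Submodule ℂ (E →L[ℂ] E))
    (u : S →ₗ[ℂ] (H →L[ℂ] H)) : Prop :=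
  ∀ (m : ℕ) (x : Matrix (Fin m) (Fin m) S),
    ‖opMatrix (x.map fun s => u s)‖ ≤ ‖opMatrix (x.map fun s => (s : E →L[ℂ] E))‖

/-! ## Positive regular free holomorphic functions -/

/-- A positive regular free holomorphic function `f = ∑_{|α| ≥ 1} a_α X_α`, given by its
coefficients. -/
structure PosRegular (n : ℕ) where
  /-- The coefficients `a_α`. -/
  coeff : Word n → ℝ
  coeff_nonneg : ∀ α, 0 ≤ coeff α
  coeff_one : coeff 1 = 0
  coeff_of_pos : ∀ i, 0 < coeff (FreeMonoid.of i)
  limsup_lt_top :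
    limsup (fun k : ℕ => ENNReal.ofReal
      ((∑ w : Fin k → Fin n, |coeff (FreeMonoid.ofList (List.ofFn w))| ^ 2) ^
        (1 / (2 * (k : ℝ))))) atTop < ⊤

/-- `factorSum a j γ` is the sum of `a_{γ₁} ⋯ a_{γⱼ}` over all factorizations `γ = γ₁ ⋯ γⱼ` of `γ`
into `j` words of length at least one (organised by the first factor `γ₁`). -/
def factorSum {n : ℕ} (a : Word n → ℝ) : ℕ → Word n → ℝ
  | 0, γ => if γ.length = 0 then 1 else 0
  | j + 1, γ => ∑ i ∈ Finset.Icc 1 γ.length,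
      a (FreeMonoid.ofList (γ.toList.take i)) *
        factorSum a j (FreeMonoid.ofList (γ.toList.drop i))

namespace PosRegular

variable {n : ℕ} (f : PosRegular n)

/-- The coefficients `b_α` of `(1 - f)⁻¹ = 1 + f + f² + ⋯`: one has `b = 1` at the empty word and
`b_α = ∑_{1 ≤ j ≤ |α|} ∑_{γ₁ ⋯ γⱼ = α, |γᵢ| ≥ 1} a_{γ₁} ⋯ a_{γⱼ}` for `|α| ≥ 1` (the term `j = 0`
only contributes at the empty word). -/
def b (α : Word n) : ℝ := ∑ j ∈ Finset.range (α.length + 1), factorSum f.coeff j α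

theorem b_one : f.b 1 = 1 := by
  simp [b, factorSum]

theorem factorSum_nonneg (j : ℕ) (γ : Word n) : 0 ≤ factorSum f.coeff j γ := by
  induction j generalizing γ with
  | zero => unfold factorSum; split_ifs <;> norm_num
  | succ j ih =>
    unfold factorSum
    exact Finset.sum_nonneg fun i _ => mul_nonneg (f.coeff_nonneg _) (ih _)

theorem coeff_mul_factorSum_le (i : Fin n) (j : ℕ) (α : Word n) :
    f.coeff (FreeMonoid.of i) * factorSum f.coeff j α ≤
      factorSum f.coeff (j + 1) (FreeMonoid.of i * α) := by
  have h := Finset.single_le_sum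
    (f := fun k => f.coeff (FreeMonoid.ofList ((FreeMonoid.of i * α).toList.take k)) *
        factorSum f.coeff j (FreeMonoid.ofList ((FreeMonoid.of i * α).toList.drop k)))
    (s := Finset.Icc 1 (FreeMonoid.of i * α).length)
    (fun k _ => mul_nonneg (f.coeff_nonneg _) (f.factorSum_nonneg _ _))
    (a := 1) (by simp [FreeMonoid.length_mul])
  exact h

theorem coeff_mul_b_le (i : Fin n) (α : Word n) :
    f.coeff (FreeMonoid.of i) * f.b α ≤ f.b (FreeMonoid.of i * α) := by
  have hl : (FreeMonoid.of i * α).length = α.length + 1 := by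
    rw [FreeMonoid.length_mul, FreeMonoid.length_of, add_comm]
  unfold b
  rw [hl, Finset.sum_range_succ' _ (α.length + 1), Finset.mul_sum]
  exact le_add_of_le_of_nonneg
    (Finset.sum_le_sum fun j _ => f.coeff_mul_factorSum_le i j α) (f.factorSum_nonneg _ _)

theorem b_pos (α : Word n) : 0 < f.b α := by
  induction α using FreeMonoid.inductionOn' with
  | one => rw [b_one]; exact one_pos
  | of_mul i α ih => exact (mul_pos (f.coeff_of_pos i) ih).trans_le (f.coeff_mul_b_le i α)

/-! ## The universal weighted shifts -/

/-- The left creation operator `S_i`, with `S_i e_α = e_{g_i α}`. -/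
def creation (i : Fin n) : Fock n →ₗᵢ[ℂ] Fock n :=
  ((fockBasis n).orthonormal.comp (fun α : Word n => FreeMonoid.of i * α)
    (mul_right_injective (FreeMonoid.of i))).orthogonalFamily.linearIsometry

theorem weight_bound (i : Fin n) (α : Word n) :
    ‖((Real.sqrt (f.b α / f.b (FreeMonoid.of i * α)) : ℝ) : ℂ) • ContinuousLinearMap.id ℂ ℂ‖ ≤
      Real.sqrt (1 / f.coeff (FreeMonoid.of i)) := by
  rw [norm_smul, ContinuousLinearMap.norm_id, mul_one, Complex.norm_real,
    Real.norm_of_nonneg (Real.sqrt_nonneg _)]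
  apply Real.sqrt_le_sqrt
  rw [div_le_div_iff₀ (f.b_pos _) (f.coeff_of_pos i), one_mul, mul_comm]
  exact f.coeff_mul_b_le i α

/-- The diagonal operator `D_i`, with `D_i e_α = √(b_α / b_{g_i α}) e_α`. -/
def diag (i : Fin n) : Fock n →L[ℂ] Fock n :=
  lp.mapCLM 2 (fun α : Word n =>
      ((Real.sqrt (f.b α / f.b (FreeMonoid.of i * α)) : ℝ) : ℂ) • ContinuousLinearMap.id ℂ ℂ)
    (Real.sqrt_nonneg _) (f.weight_bound i)

/-- The weighted left creation operators `W_i = S_i D_i` associated with `f`. -/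
def W (i : Fin n) : Fock n →L[ℂ] Fock n :=
  (creation i).toContinuousLinearMap.comp (f.diag i)

/-- The norm closed linear span of the operators `W_α W_β*`. -/
def poissonSpace : Submodule ℂ (Fock n →L[ℂ] Fock n) :=
  (Submodule.span ℂ (Set.range fun p : Word n × Word n =>
    opWord f.W p.1 * star (opWord f.W p.2))).topologicalClosure

theorem mem_poissonSpace (α β : Word n) :
    opWord f.W α * star (opWord f.W β) ∈ f.poissonSpace :=
  Submodule.le_topologicalClosure _ (Submodule.subset_span ⟨(α, β), rfl⟩)

theorem one_mem_poissonSpace : (1 : Fock n →L[ℂ] Fock n) ∈ f.poissonSpace := by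
  simpa [opWord] using f.mem_poissonSpace 1 1

/-! ## The noncommutative domain and the Poisson kernel -/

variable {H : Type*} [NormedAddCommGroup H] [InnerProductSpace ℂ H] [CompleteSpace H]

/-- The terms `a_α T_α X T_α*` of the series `Φ_{f,T}(X)`, in `B(H)` with the weak operator
topology. -/
def phiTerm (T : Fin n → H →L[ℂ] H) (X : H →L[ℂ] H) (α : Word n) : H →WOT[ℂ] H :=
  ContinuousLinearMapWOT.ofCLM
    ((f.coeff α : ℂ) • (opWord T α * X * star (opWord T α)))

/-- `Φ_{f,T}(X) = ∑_{|α| ≥ 1} a_α T_α X T_α*`, with convergence in the weak operator topology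
(the coefficient of the empty word is zero). -/
def Phi (T : Fin n → H →L[ℂ] H) (X : H →L[ℂ] H) : H →L[ℂ] H :=
  ContinuousLinearMapWOT.toCLM (∑' α, f.phiTerm T X α)

variable (H) in
/-- The noncommutative domain `𝒟_f(H)`: the `n`-tuples for which `∑_{|α| ≥ 1} a_α T_α T_α*`
converges in the weak operator topology to an operator of norm at most one. -/
def domain : Set (Fin n → H →L[ℂ] H) :=
  {T | Summable (f.phiTerm T 1) ∧ ‖f.Phi T 1‖ ≤ 1}

/-- The defect operator `Δ_{f,T} = (I - Φ_{f,T}(I))^{1/2}`. -/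
def defect (T : Fin n → H →L[ℂ] H) : H →L[ℂ] H :=
  CFC.sqrt (1 - f.Phi T 1)

/-- `K` is the Poisson kernel `K_{f,T} h = ∑_α √b_α e_α ⊗ Δ_{f,T} T_α* h`. -/
def IsPoissonKernel (T : Fin n → H →L[ℂ] H) (K : H →L[ℂ] HTensor (Fock n) H) : Prop :=
  ∀ h : H, HasSum
    (fun α : Word n => ((Real.sqrt (f.b α) : ℝ) : ℂ) •
      ((fockBasis n α ⊗ₜ[ℂ] f.defect T (star (opWord T α) h) : Fock n ⊗[ℂ] H) :
        HTensor (Fock n) H))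
    (K h)

end PosRegular

end NCDomain

end

open scoped ENNReal

noncomputable section

namespace NCDomain

/-! ## Summation over words -/

/-! The coefficients `b` are those of `(1 - f)⁻¹`, so they satisfy the noncommutative form of `(1 -
f)⁻¹ = 1 + (1 - f)⁻¹ f` (`bPairing_eq_add`). Since `f` has no constant term, `∑ a_γ ‖(rT)_γ* h‖² ≤
r² ‖h‖²`, and a geometric series shows that `∑ b_β ‖(rT)_β* h‖²` is finite for `r < 1`. The identity
for `b` can therefore be cancelled against `‖Δx‖² + ∑ a_γ ‖(rT)_γ* x‖² = ‖x‖²`, which leaves `∑ b_β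
‖Δ (rT)_β* h‖² = ‖h‖²` (`bPairing_defect`). This says that the Poisson kernel of `rT` is an isometry
(`exists_isPoissonKernel`).

The weights of `W_i` are chosen so that `(W_i* ⊗ I) K = K (rT_i)*`. With `K* K = I` this gives `K*
(W_α W_β* ⊗ I) K = r^(|α|+|β|) T_α T_β*` (`compression_opWord`). Each map `g ↦ K* (g ⊗ I) K` is
completely contractive (`opMatrix_compression_norm_le`). As `r → 1` these maps converge on every
`W_α W_β*`, hence on the span, and by uniform contractivity on its closure. The limit is `Ψ`; the
bounds on matrices survive it, and the von Neumann inequality is the contractivity of `Ψ`. -/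

/-- A word together with a cutting position is the same as a pair of words. -/
def cutEquiv (n : ℕ) : (Σ β : Word n, Fin (β.length + 1)) ≃ Word n × Word n where
  toFun p := (FreeMonoid.ofList (p.1.toList.take p.2), FreeMonoid.ofList (p.1.toList.drop p.2))
  invFun q := ⟨q.1 * q.2, ⟨q.1.length, by rw [FreeMonoid.length_mul]; omega⟩⟩
  left_inv := by
    rintro ⟨β, i, hi⟩
    have hmul : (FreeMonoid.ofList (β.toList.take i) : Word n) *
        FreeMonoid.ofList (β.toList.drop i) = β := by
      rw [← FreeMonoid.ofList_append, List.take_append_drop, FreeMonoid.ofList_toList]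
    have hlen : (FreeMonoid.ofList (β.toList.take i) : Word n).length = i := by
      change (β.toList.take i).length = i
      rw [List.length_take]
      exact min_eq_left (Nat.lt_succ_iff.mp hi)
    -- The type of the cutting position depends on the word, so word and position are generalized
    -- together and then substituted.
    have key : ∀ (γ : Word n) (k : ℕ) (hk : k < γ.length + 1), γ = β → k = i →
        (⟨γ, k, hk⟩ : Σ β : Word n, Fin (β.length + 1)) = ⟨β, i, hi⟩ := by
      rintro γ k hk rfl rfl; rfl
    exact key _ _ _ hmul hlen
  right_inv := by
    rintro ⟨γ, α⟩
    have h1 : (γ * α).toList.take γ.length = γ.toList := by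
      rw [FreeMonoid.toList_mul]; exact List.take_left
    have h2 : (γ * α).toList.drop γ.length = α.toList := by
      rw [FreeMonoid.toList_mul]; exact List.drop_left
    simp only [h1, h2, FreeMonoid.ofList_toList]

/-- The Cauchy product rearrangement for concatenation of words. Values in `ℝ≥0∞` make it
unconditional. -/
theorem tsum_cut {n : ℕ} (G : Word n → Word n → ℝ≥0∞) :
    ∑' β : Word n, ∑ i ∈ Finset.range (β.length + 1),
      G (FreeMonoid.ofList (β.toList.take i)) (FreeMonoid.ofList (β.toList.drop i)) =
    ∑' γ, ∑' α, G γ α := by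
  rw [← ENNReal.tsum_prod (f := G), ← (cutEquiv n).tsum_eq, ENNReal.tsum_sigma']
  refine tsum_congr fun β => ?_
  rw [tsum_fintype, Finset.sum_range]
  rfl

theorem ofList_take_mul_drop {n : ℕ} (β : Word n) (i : ℕ) :
    (FreeMonoid.ofList (β.toList.take i) : Word n) * FreeMonoid.ofList (β.toList.drop i) = β := by
  rw [← FreeMonoid.ofList_append, List.take_append_drop, FreeMonoid.ofList_toList]

namespace PosRegular

variable {n : ℕ} (f : PosRegular n)

/-- The weighted sum `∑_β c_j(β) F(β)`, where `c_j(β)` is the sum of the products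
`a_{γ₁} ⋯ a_{γⱼ}` over the factorizations of `β` into `j` nonempty words. -/
def factorPairing (j : ℕ) (F : Word n → ℝ≥0∞) : ℝ≥0∞ :=
  ∑' β, ENNReal.ofReal (factorSum f.coeff j β) * F β

/-- The weighted sum `∑_β b_β F(β)`. -/
def bPairing (F : Word n → ℝ≥0∞) : ℝ≥0∞ :=
  ∑' β, ENNReal.ofReal (f.b β) * F β

theorem factorPairing_zero (F : Word n → ℝ≥0∞) : f.factorPairing 0 F = F 1 := by
  unfold factorPairing
  rw [tsum_eq_single 1]
  · simp [factorSum]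
  · intro β hβ
    have : β.length ≠ 0 := fun h => hβ (FreeMonoid.length_eq_zero.mp h)
    simp [factorSum, this]

/-- Peels off the first factor, following the recursion of `factorSum`. -/
theorem factorPairing_succ (j : ℕ) (F : Word n → ℝ≥0∞) :
    f.factorPairing (j + 1) F =
      ∑' γ, ENNReal.ofReal (f.coeff γ) * f.factorPairing j (fun α => F (γ * α)) := by
  unfold factorPairing
  simp_rw [← ENNReal.tsum_mul_left]
  rw [← tsum_cut]
  refine tsum_congr fun β => ?_
  rw [factorSum, ENNReal.ofReal_sum_of_nonneg
    (fun i _ => mul_nonneg (f.coeff_nonneg _) (f.factorSum_nonneg _ _)), Finset.sum_mul]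
  have hsub : Finset.Icc 1 β.length ⊆ Finset.range (β.length + 1) := by
    intro i hi
    rw [Finset.mem_Icc] at hi
    exact Finset.mem_range.mpr (by omega)
  -- The cut at position `0` may be added, because its first factor is the empty word, where `a`
  -- vanishes.
  rw [← Finset.sum_subset hsub]
  · refine Finset.sum_congr rfl fun i _ => ?_
    rw [ofList_take_mul_drop, ENNReal.ofReal_mul (f.coeff_nonneg _), mul_assoc]
  · intro i hi hi'
    have : i = 0 := by
      rw [Finset.mem_range] at hi
      rw [Finset.mem_Icc] at hi'
      omega
    subst this
    have h1 : (FreeMonoid.ofList (β.toList.take 0) : Word n) = 1 := by simp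
    rw [h1, f.coeff_one, ENNReal.ofReal_zero, zero_mul]

/-- Peels off the last factor instead. This side is the one needed later: in `T_{βγ}* h = T_γ* (T_β*
h)` the sum over `γ` then acts on the vector `T_β* h`, to which the defect identity applies. -/
theorem factorPairing_succ' (j : ℕ) (F : Word n → ℝ≥0∞) :
    f.factorPairing (j + 1) F =
      f.factorPairing j (fun β => ∑' γ, ENNReal.ofReal (f.coeff γ) * F (β * γ)) := by
  induction j generalizing F with
  | zero => simp_rw [factorPairing_succ, factorPairing_zero, mul_one, one_mul]
  | succ j ih =>
    rw [factorPairing_succ, factorPairing_succ]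
    refine tsum_congr fun γ => ?_
    rw [ih]
    simp_rw [mul_assoc]

theorem factorSum_eq_zero_of_length_lt (j : ℕ) (γ : Word n) (h : γ.length < j) :
    factorSum f.coeff j γ = 0 := by
  induction j generalizing γ with
  | zero => omega
  | succ j ih =>
    unfold factorSum
    refine Finset.sum_eq_zero fun i hi => ?_
    rw [Finset.mem_Icc] at hi
    rw [ih, mul_zero]
    change (γ.toList.drop i).length < j
    rw [List.length_drop]
    change γ.length - i < j
    omega

/-- A word of length `k` has no factorization into more than `k` nonempty words, so the finite sum
defining `b` is the full Neumann series. -/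
theorem bPairing_eq_tsum (F : Word n → ℝ≥0∞) : f.bPairing F = ∑' j, f.factorPairing j F := by
  unfold bPairing factorPairing
  rw [ENNReal.tsum_comm]
  refine tsum_congr fun β => ?_
  rw [ENNReal.tsum_mul_right]
  congr 1
  rw [b, ENNReal.ofReal_sum_of_nonneg (fun j _ => f.factorSum_nonneg j β), tsum_eq_sum]
  intro j hj
  rw [Finset.mem_range] at hj
  rw [f.factorSum_eq_zero_of_length_lt j β (by omega), ENNReal.ofReal_zero]

theorem bPairing_eq_add (F : Word n → ℝ≥0∞) :
    f.bPairing F =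
      F 1 + f.bPairing (fun β => ∑' γ, ENNReal.ofReal (f.coeff γ) * F (β * γ)) := by
  rw [bPairing_eq_tsum, bPairing_eq_tsum, tsum_eq_zero_add' ENNReal.summable, factorPairing_zero]
  simp_rw [factorPairing_succ']

end PosRegular

/-! ## Summability along the orbit of a strict row contraction -/

section Orbit

variable {n : ℕ} {H : Type*} [NormedAddCommGroup H] [InnerProductSpace ℂ H]

theorem opWord_one (T : Fin n → H →L[ℂ] H) : opWord T 1 = 1 := map_one _

theorem opWord_of (T : Fin n → H →L[ℂ] H) (i : Fin n) : opWord T (FreeMonoid.of i) = T i :=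
  FreeMonoid.lift_eval_of _ _

theorem opWord_mul (T : Fin n → H →L[ℂ] H) (α β : Word n) :
    opWord T (α * β) = opWord T α * opWord T β := map_mul _ _ _

theorem opWord_smul (r : ℂ) (T : Fin n → H →L[ℂ] H) (α : Word n) :
    opWord (fun i => r • T i) α = r ^ α.length • opWord T α := by
  induction α using FreeMonoid.inductionOn' with
  | one => simp [opWord_one]
  | of_mul i α ih =>
    rw [opWord_mul, opWord_mul, ih, opWord_of, opWord_of, FreeMonoid.length_mul,
      FreeMonoid.length_of, smul_mul_smul_comm, pow_add, pow_one]

variable [CompleteSpace H]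

theorem star_opWord_mul_apply (T : Fin n → H →L[ℂ] H) (α β : Word n) (h : H) :
    star (opWord T (α * β)) h = star (opWord T β) (star (opWord T α) h) := by
  rw [opWord_mul, star_mul]; rfl

namespace PosRegular

variable (f : PosRegular n)

/-- Here the first factor is peeled off: since `T_{γα}* h = T_α* (T_γ* h)`, the induction hypothesis
applies to the vector `T_γ* h`, and the sum over `γ` contributes one more `ρ`. -/
theorem factorPairing_orbit_le {T : Fin n → H →L[ℂ] H} {ρ : ℝ≥0∞}
    (hT : ∀ h : H, ∑' γ, ENNReal.ofReal (f.coeff γ) * ‖star (opWord T γ) h‖ₑ ^ 2 ≤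
      ρ * ‖h‖ₑ ^ 2) (j : ℕ) (h : H) :
    f.factorPairing j (fun β => ‖star (opWord T β) h‖ₑ ^ 2) ≤ ρ ^ j * ‖h‖ₑ ^ 2 := by
  induction j generalizing h with
  | zero => simp [factorPairing_zero, opWord_one]
  | succ j ih =>
    rw [factorPairing_succ]
    simp_rw [star_opWord_mul_apply]
    calc _ ≤ ∑' γ, ENNReal.ofReal (f.coeff γ) * (ρ ^ j * ‖star (opWord T γ) h‖ₑ ^ 2) :=
          ENNReal.tsum_le_tsum fun γ => mul_le_mul_right (ih _) _
      _ = ρ ^ j * ∑' γ, ENNReal.ofReal (f.coeff γ) * ‖star (opWord T γ) h‖ₑ ^ 2 := by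
          rw [← ENNReal.tsum_mul_left]
          exact tsum_congr fun γ => mul_left_comm _ _ _
      _ ≤ ρ ^ j * (ρ * ‖h‖ₑ ^ 2) := mul_le_mul_right (hT h) _
      _ = _ := by rw [pow_succ ρ, mul_assoc]

theorem bPairing_orbit_lt_top {T : Fin n → H →L[ℂ] H} {ρ : ℝ≥0∞} (hρ : ρ < 1)
    (hT : ∀ h : H, ∑' γ, ENNReal.ofReal (f.coeff γ) * ‖star (opWord T γ) h‖ₑ ^ 2 ≤
      ρ * ‖h‖ₑ ^ 2) (h : H) :
    f.bPairing (fun β => ‖star (opWord T β) h‖ₑ ^ 2) < ⊤ := by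
  rw [bPairing_eq_tsum]
  refine (ENNReal.tsum_le_tsum fun j => f.factorPairing_orbit_le hT j h).trans_lt ?_
  rw [ENNReal.tsum_mul_right, ENNReal.tsum_geometric]
  refine ENNReal.mul_lt_top ?_ (ENNReal.pow_lt_top enorm_lt_top)
  rw [ENNReal.inv_lt_top]
  exact tsub_pos_of_lt hρ

/-- If `D` is a defect operator of a strict row contraction, then
`∑_α b_α ‖D T_α* h‖² = ‖h‖²`. -/
theorem bPairing_defect {T : Fin n → H →L[ℂ] H} {D : H →L[ℂ] H} {ρ : ℝ≥0∞} (hρ : ρ < 1)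
    (hT : ∀ h : H, ∑' γ, ENNReal.ofReal (f.coeff γ) * ‖star (opWord T γ) h‖ₑ ^ 2 ≤
      ρ * ‖h‖ₑ ^ 2)
    (hD : ∀ h : H, ‖D h‖ₑ ^ 2 +
      ∑' γ, ENNReal.ofReal (f.coeff γ) * ‖star (opWord T γ) h‖ₑ ^ 2 = ‖h‖ₑ ^ 2) (h : H) :
    f.bPairing (fun β => ‖D (star (opWord T β) h)‖ₑ ^ 2) = ‖h‖ₑ ^ 2 := by
  have hfin := f.bPairing_orbit_lt_top hρ hT h
  have h1 := f.bPairing_eq_add (fun β => ‖star (opWord T β) h‖ₑ ^ 2)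
  simp_rw [star_opWord_mul_apply] at h1
  have h2 : f.bPairing (fun β => ‖star (opWord T β) h‖ₑ ^ 2) =
      f.bPairing (fun β => ‖D (star (opWord T β) h)‖ₑ ^ 2) +
      f.bPairing (fun β => ∑' γ, ENNReal.ofReal (f.coeff γ) *
        ‖star (opWord T γ) (star (opWord T β) h)‖ₑ ^ 2) := by
    unfold bPairing
    rw [← ENNReal.tsum_add]
    refine tsum_congr fun β => ?_
    rw [← mul_add, hD]
  have hfin' := hfin
  rw [h1] at hfin'
  -- Finiteness of the common term allows it to be cancelled in `ℝ≥0∞`; strictness of the row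
  -- contraction is used only for this.
  have hR := (le_add_self.trans_lt hfin').ne
  rw [h1, opWord_one, star_one, one_apply_eq_self] at h2
  exact ((ENNReal.add_left_inj hR).mp h2).symm

end PosRegular

end Orbit

/-! ## Matrices of operators -/

section OpMatrix

variable {m : ℕ} {E : Type*} [NormedAddCommGroup E] [InnerProductSpace ℂ E]

theorem opMatrix_apply (A : Matrix (Fin m) (Fin m) (E →L[ℂ] E))
    (x : PiLp 2 (fun _ : Fin m => E)) (i : Fin m) :
    opMatrix A x i = ∑ j, A i j (x j) := by
  simp [opMatrix]

theorem sum_norm_sq_le_of_opMatrix (A : Matrix (Fin m) (Fin m) (E →L[ℂ] E)) (x : Fin m → E) :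
    ∑ i, ‖∑ j, A i j (x j)‖ ^ 2 ≤ ‖opMatrix A‖ ^ 2 * ∑ j, ‖x j‖ ^ 2 := by
  have h := (opMatrix A).le_opNorm (WithLp.toLp 2 x)
  have h2 := pow_le_pow_left₀ (norm_nonneg _) h 2
  rw [mul_pow, PiLp.norm_sq_eq_of_L2, PiLp.norm_sq_eq_of_L2] at h2
  simpa only [opMatrix_apply] using h2

/-- Together with `sum_norm_sq_le_of_opMatrix`, this trades the operator norm on the direct sum for
a quadratic inequality on tuples, which is easy to compress and to pass to limits. -/
theorem opMatrix_norm_le (A : Matrix (Fin m) (Fin m) (E →L[ℂ] E)) {C : ℝ} (hC : 0 ≤ C)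
    (h : ∀ x : Fin m → E, ∑ i, ‖∑ j, A i j (x j)‖ ^ 2 ≤ C ^ 2 * ∑ j, ‖x j‖ ^ 2) :
    ‖opMatrix A‖ ≤ C := by
  refine ContinuousLinearMap.opNorm_le_bound _ hC fun x => ?_
  refine le_of_sq_le_sq ?_ (by positivity)
  rw [mul_pow, PiLp.norm_sq_eq_of_L2, PiLp.norm_sq_eq_of_L2]
  simpa only [opMatrix_apply] using h x.ofLp

end OpMatrix

/-! ## Operators on Hilbert tensor products -/

section Tensor

variable {E : Type*} [NormedAddCommGroup E] [InnerProductSpace ℂ E]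
  {F : Type*} [NormedAddCommGroup F] [InnerProductSpace ℂ F]

theorem HTensor.denseRange_coe :
    DenseRange (fun x : E ⊗[ℂ] F => (x : HTensor E F)) :=
  UniformSpace.Completion.denseRange_coe

theorem ampliation_coe_tmul (g : E →L[ℂ] E) (x : E) (y : F) :
    ampliation F g ((x ⊗ₜ[ℂ] y : E ⊗[ℂ] F) : HTensor E F) =
      ((g x ⊗ₜ[ℂ] y : E ⊗[ℂ] F) : HTensor E F) := by
  rw [ampliation_coe, ContinuousLinearMap.rTensor_tmul]

theorem clm_ext_coe {G : Type*} [NormedAddCommGroup G] [NormedSpace ℂ G]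
    {u v : HTensor E F →L[ℂ] G} (h : ∀ x : E ⊗[ℂ] F, u (x : HTensor E F) = v (x : HTensor E F)) :
    u = v :=
  ContinuousLinearMap.ext fun z =>
    congrFun (HTensor.denseRange_coe.equalizer u.continuous v.continuous (funext h)) z

variable (F) in
theorem ampliation_add (g₁ g₂ : E →L[ℂ] E) :
    ampliation F (g₁ + g₂) = ampliation F g₁ + ampliation F g₂ :=
  clm_ext_coe fun x => by
    rw [add_apply, ampliation_coe, ampliation_coe, ampliation_coe,
      ContinuousLinearMap.rTensor_add, add_apply,
      UniformSpace.Completion.coe_add]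

variable (F) in
theorem ampliation_smul (c : ℂ) (g : E →L[ℂ] E) :
    ampliation F (c • g) = c • ampliation F g :=
  clm_ext_coe fun x => by
    rw [smul_apply, ampliation_coe, ampliation_coe,
      ContinuousLinearMap.rTensor_smul, smul_apply,
      UniformSpace.Completion.coe_smul]

variable (F) in
theorem ampliation_mul (g₁ g₂ : E →L[ℂ] E) :
    ampliation F (g₁ * g₂) = ampliation F g₁ * ampliation F g₂ :=
  clm_ext_coe fun x => by
    rw [mul_apply_eq_comp, ampliation_coe, ampliation_coe, ampliation_coe,
      ContinuousLinearMap.rTensor_mul, mul_apply_eq_comp]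

variable (E F) in
theorem ampliation_one : ampliation F (1 : E →L[ℂ] E) = 1 :=
  clm_ext_coe fun x => by
    rw [ampliation_coe, ContinuousLinearMap.rTensor_one]; rfl

/-- The isometric embedding of `E` as the `i`-th summand of `E⁽ᵐ⁾`. -/
def summandEmbedding (E : Type*) [NormedAddCommGroup E] [InnerProductSpace ℂ E] {m : ℕ}
    (i : Fin m) : E →ₗᵢ[ℂ] PiLp 2 (fun _ : Fin m => E) where
  toFun x := PiLp.single 2 i x
  map_add' _ _ := PiLp.single_add 2 i
  map_smul' c x := by
    refine PiLp.ext fun j => ?_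
    by_cases h : j = i
    · subst h
      simp only [PiLp.smul_apply, PiLp.single_eq_same, RingHom.id_apply]
    · simp only [PiLp.smul_apply, PiLp.single_eq_of_ne 2 h, RingHom.id_apply, smul_zero]
  norm_map' x := PiLp.norm_single 2 (fun _ : Fin m => E) i x

theorem summandEmbedding_apply {m : ℕ} (i : Fin m) (x : E) :
    summandEmbedding E i x = PiLp.single 2 i x := rfl

theorem inner_rTensor_summandEmbedding {m : ℕ} {i j : Fin m} (hij : i ≠ j) (z w : E ⊗[ℂ] F) :
    ⟪(summandEmbedding E i).rTensor F z, (summandEmbedding E j).rTensor F w⟫_ℂ = 0 := by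
  induction z using TensorProduct.induction_on with
  | zero => simp
  | add z₁ z₂ h₁ h₂ => rw [map_add, inner_add_left, h₁, h₂, add_zero]
  | tmul x y =>
    induction w using TensorProduct.induction_on with
    | zero => simp
    | add w₁ w₂ h₁ h₂ => rw [map_add, inner_add_right, h₁, h₂, add_zero]
    | tmul x' y' =>
      change ⟪summandEmbedding E i x ⊗ₜ[ℂ] y, summandEmbedding E j x' ⊗ₜ[ℂ] y'⟫_ℂ = 0
      rw [TensorProduct.inner_tmul, summandEmbedding_apply, summandEmbedding_apply,
        PiLp.inner_apply]
      have : ∑ k, ⟪(PiLp.single 2 i x : PiLp 2 (fun _ : Fin m => E)) k,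
          (PiLp.single 2 j x' : PiLp 2 (fun _ : Fin m => E)) k⟫_ℂ = 0 := by
        refine Finset.sum_eq_zero fun k _ => ?_
        by_cases hk : k = i
        · subst hk; rw [PiLp.single_eq_of_ne 2 hij, inner_zero_right]
        · rw [PiLp.single_eq_of_ne 2 hk, inner_zero_left]
      rw [this, zero_mul]

theorem norm_sq_sum_rTensor_summandEmbedding {m : ℕ} (z : Fin m → E ⊗[ℂ] F) :
    ‖∑ j, (summandEmbedding E j).rTensor F (z j)‖ ^ 2 = ∑ j, ‖z j‖ ^ 2 :=
  OrthogonalFamily.norm_sum (𝕜 := ℂ) (G := fun _ : Fin m => E ⊗[ℂ] F)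
    (V := fun j => (summandEmbedding E j).rTensor F)
    (fun _ _ hij z w => inner_rTensor_summandEmbedding hij z w) z Finset.univ

theorem opMatrix_rTensor_summandEmbedding {m : ℕ} (A : Matrix (Fin m) (Fin m) (E →L[ℂ] E))
    (j : Fin m) (z : E ⊗[ℂ] F) :
    (opMatrix A).rTensor F ((summandEmbedding E j).rTensor F z) =
      ∑ i, (summandEmbedding E i).rTensor F ((A i j).rTensor F z) := by
  induction z using TensorProduct.induction_on with
  | zero => simp
  | add z₁ z₂ h₁ h₂ => simp only [map_add, h₁, h₂, Finset.sum_add_distrib]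
  | tmul x y =>
    change (opMatrix A (summandEmbedding E j x)) ⊗ₜ[ℂ] y =
      ∑ i, (summandEmbedding E i (A i j x)) ⊗ₜ[ℂ] y
    rw [← TensorProduct.sum_tmul]
    congr 1
    ext k
    rw [opMatrix_apply, WithLp.ofLp_sum, Finset.sum_apply, Finset.sum_eq_single j,
      Finset.sum_eq_single k]
    · simp only [summandEmbedding_apply, PiLp.single_eq_same]
    · intro i _ hi; rw [summandEmbedding_apply, PiLp.single_eq_of_ne' 2 hi]
    · simp
    · intro i _ hi; rw [summandEmbedding_apply, PiLp.single_eq_of_ne 2 hi, map_zero]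
    · simp

/-- The summand embeddings identify `(E ⊗ F)⁽ᵐ⁾` isometrically with `E⁽ᵐ⁾ ⊗ F`. Under this
identification the matrix `[A i j ⊗ I]` becomes `opMatrix A ⊗ I`, and tensoring with the identity
does not increase the norm. -/
theorem sum_norm_sq_rTensor_le {m : ℕ} (A : Matrix (Fin m) (Fin m) (E →L[ℂ] E))
    (z : Fin m → E ⊗[ℂ] F) :
    ∑ i, ‖∑ j, (A i j).rTensor F (z j)‖ ^ 2 ≤ ‖opMatrix A‖ ^ 2 * ∑ j, ‖z j‖ ^ 2 := by
  rw [← norm_sq_sum_rTensor_summandEmbedding, ← norm_sq_sum_rTensor_summandEmbedding, ← mul_pow]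
  have h : ∑ i, (summandEmbedding E i).rTensor F (∑ j, (A i j).rTensor F (z j)) =
      (opMatrix A).rTensor F (∑ j, (summandEmbedding E j).rTensor F (z j)) := by
    rw [map_sum]
    simp_rw [opMatrix_rTensor_summandEmbedding, map_sum]
    exact Finset.sum_comm
  rw [h]
  refine pow_le_pow_left₀ (norm_nonneg _) ?_ 2
  exact (ContinuousLinearMap.le_opNorm _ _).trans
    (mul_le_mul_of_nonneg_right (ContinuousLinearMap.norm_rTensor_le F _) (norm_nonneg _))

theorem sum_norm_sq_ampliation_le {m : ℕ} (A : Matrix (Fin m) (Fin m) (E →L[ℂ] E))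
    (z : Fin m → HTensor E F) :
    ∑ i, ‖∑ j, ampliation F (A i j) (z j)‖ ^ 2 ≤ ‖opMatrix A‖ ^ 2 * ∑ j, ‖z j‖ ^ 2 := by
  have hd : DenseRange (Pi.map fun (_ : Fin m) (x : E ⊗[ℂ] F) => (x : HTensor E F)) :=
    DenseRange.piMap fun _ => HTensor.denseRange_coe
  refine hd.induction_on z (isClosed_le ?_ ?_) fun y => ?_
  · fun_prop
  · fun_prop
  · have h := sum_norm_sq_rTensor_le A y
    have key : ∀ i, ∑ j, ampliation F (A i j) (y j : HTensor E F) =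
        ((∑ j, (A i j).rTensor F (y j) : E ⊗[ℂ] F) : HTensor E F) := by
      intro i
      simp_rw [ampliation_coe]
      exact (map_sum (UniformSpace.Completion.toComplL : (E ⊗[ℂ] F) →L[ℂ] HTensor E F) _ _).symm
    simp only [Pi.map_apply, key, UniformSpace.Completion.norm_coe]
    exact h

variable (F) in
theorem norm_ampliation_le (g : E →L[ℂ] E) : ‖ampliation F g‖ ≤ ‖g‖ := by
  refine ContinuousLinearMap.opNorm_le_bound _ (norm_nonneg _) fun z => ?_
  refine HTensor.denseRange_coe.induction_on z (isClosed_le (by fun_prop) (by fun_prop))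
    fun y => ?_
  rw [ampliation_coe, UniformSpace.Completion.norm_coe, UniformSpace.Completion.norm_coe]
  exact (ContinuousLinearMap.le_opNorm _ _).trans
    (mul_le_mul_of_nonneg_right (ContinuousLinearMap.norm_rTensor_le F _) (norm_nonneg _))

/-! ## Compressions of ampliations -/

variable [CompleteSpace F]

/-- The map `g ↦ K*(g ⊗ I)K`. -/
def compression (K : F →L[ℂ] HTensor E F) : (E →L[ℂ] E) →ₗ[ℂ] (F →L[ℂ] F) where
  toFun g := (ContinuousLinearMap.adjoint K).comp ((ampliation F g).comp K)
  map_add' g₁ g₂ := by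
    rw [ampliation_add, ContinuousLinearMap.add_comp, ContinuousLinearMap.comp_add]
  map_smul' c g := by
    rw [ampliation_smul, ContinuousLinearMap.smul_comp, ContinuousLinearMap.comp_smul,
      RingHom.id_apply]

theorem norm_adjoint_apply_le {K : F →L[ℂ] HTensor E F} (hK : ‖K‖ ≤ 1) (z : HTensor E F) :
    ‖ContinuousLinearMap.adjoint K z‖ ≤ ‖z‖ := by
  refine ContinuousLinearMap.le_of_opNorm_le _ ?_ z |>.trans_eq (one_mul _)
  rwa [LinearIsometryEquiv.norm_map]

theorem compression_norm_le {K : F →L[ℂ] HTensor E F} (hK : ‖K‖ ≤ 1) (g : E →L[ℂ] E) :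
    ‖compression K g‖ ≤ ‖g‖ := by
  refine ContinuousLinearMap.opNorm_le_bound _ (norm_nonneg _) fun h => ?_
  calc ‖ContinuousLinearMap.adjoint K (ampliation F g (K h))‖
      ≤ ‖ampliation F g (K h)‖ := norm_adjoint_apply_le hK _
    _ ≤ ‖ampliation F g‖ * ‖K h‖ := ContinuousLinearMap.le_opNorm _ _
    _ ≤ ‖g‖ * ‖h‖ := mul_le_mul (norm_ampliation_le F g)
        ((K.le_of_opNorm_le hK h).trans_eq (one_mul _)) (norm_nonneg _) (norm_nonneg _)

/-- The compressed matrix is `[A i j ⊗ I]` placed between the diagonal contractions with entries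
`K*` and `K`. -/
theorem opMatrix_compression_norm_le {m : ℕ} {K : F →L[ℂ] HTensor E F} (hK : ‖K‖ ≤ 1)
    (A : Matrix (Fin m) (Fin m) (E →L[ℂ] E)) :
    ‖opMatrix (A.map (compression K))‖ ≤ ‖opMatrix A‖ := by
  refine opMatrix_norm_le _ (ContinuousLinearMap.opNorm_nonneg _) fun x => ?_
  calc ∑ i, ‖∑ j, compression K (A i j) (x j)‖ ^ 2
      = ∑ i, ‖ContinuousLinearMap.adjoint K (∑ j, ampliation F (A i j) (K (x j)))‖ ^ 2 := by
        simp_rw [map_sum]; rfl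
    _ ≤ ∑ i, ‖∑ j, ampliation F (A i j) (K (x j))‖ ^ 2 :=
        Finset.sum_le_sum fun i _ =>
          pow_le_pow_left₀ (norm_nonneg _) (norm_adjoint_apply_le hK _) 2
    _ ≤ ‖opMatrix A‖ ^ 2 * ∑ j, ‖K (x j)‖ ^ 2 := sum_norm_sq_ampliation_le A _
    _ ≤ ‖opMatrix A‖ ^ 2 * ∑ j, ‖x j‖ ^ 2 := by
        refine mul_le_mul_of_nonneg_left (Finset.sum_le_sum fun j _ => ?_) (by positivity)
        exact pow_le_pow_left₀ (norm_nonneg _) ((K.le_of_opNorm_le hK _).trans_eq (one_mul _)) 2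

/-- For a fixed tuple both sides of the quadratic inequality involve finitely many entries, so
entrywise norm limits preserve it. -/
theorem opMatrix_norm_le_of_tendsto {ι : Type*} {l : Filter ι} [l.NeBot] {m : ℕ}
    {A : ι → Matrix (Fin m) (Fin m) (E →L[ℂ] E)} {B : Matrix (Fin m) (Fin m) (E →L[ℂ] E)}
    {C : ℝ} (hC : 0 ≤ C) (hA : ∀ t, ‖opMatrix (A t)‖ ≤ C)
    (h : ∀ i j, Tendsto (fun t => A t i j) l (𝓝 (B i j))) : ‖opMatrix B‖ ≤ C := by
  refine opMatrix_norm_le _ hC fun x => ?_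
  have hlim : Tendsto (fun t => ∑ i, ‖∑ j, A t i j (x j)‖ ^ 2) l
      (𝓝 (∑ i, ‖∑ j, B i j (x j)‖ ^ 2)) :=
    tendsto_finsetSum _ fun i _ => ((tendsto_finsetSum _ fun j _ =>
      ((ContinuousLinearMap.apply ℂ E (x j)).continuous.tendsto _).comp (h i j)).norm).pow 2
  refine le_of_tendsto hlim (Eventually.of_forall fun t => ?_)
  refine (sum_norm_sq_le_of_opMatrix (A t) x).trans
    (mul_le_mul_of_nonneg_right (pow_le_pow_left₀ (ContinuousLinearMap.opNorm_nonneg _) (hA t) 2) ?_)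
  positivity

end Tensor

/-! ## Operators controlled by their quadratic forms -/

section QuadraticForm

variable {H : Type*} [NormedAddCommGroup H] [InnerProductSpace ℂ H]

/-- Over `ℂ` a real quadratic form already forces self-adjointness, so the values `s x` alone decide
positivity. -/
theorem nonneg_of_inner_eq {P : H →L[ℂ] H} {s : H → ℝ} (hs : ∀ x, ⟪x, P x⟫_ℂ = (s x : ℂ))
    (h0 : ∀ x, 0 ≤ s x) : 0 ≤ P := by
  rw [ContinuousLinearMap.nonneg_iff_isPositive, ContinuousLinearMap.isPositive_iff_complex]
  intro x
  have h : ⟪P x, x⟫_ℂ = (s x : ℂ) := by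
    rw [← inner_conj_symm, hs, Complex.conj_ofReal]
  rw [h]
  exact ⟨rfl, h0 x⟩

variable [CompleteSpace H]

theorem norm_le_of_inner_eq {P : H →L[ℂ] H} {s : H → ℝ} {C : ℝ} (hC : 0 ≤ C)
    (hs : ∀ x, ⟪x, P x⟫_ℂ = (s x : ℂ)) (h0 : ∀ x, 0 ≤ s x) (h1 : ∀ x, s x ≤ C * ‖x‖ ^ 2) :
    ‖P‖ ≤ C := by
  rw [CStarAlgebra.norm_le_iff_le_algebraMap P hC (nonneg_of_inner_eq hs h0), ← sub_nonneg]
  refine nonneg_of_inner_eq (s := fun x => C * ‖x‖ ^ 2 - s x) (fun x => ?_)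
    fun x => sub_nonneg.mpr (h1 x)
  have : (algebraMap ℝ (H →L[ℂ] H) C) x = (C : ℂ) • x := by
    rw [Algebra.algebraMap_eq_smul_one]; rfl
  rw [sub_apply, inner_sub_right, hs, this, inner_smul_right, inner_self_eq_norm_sq_to_K]
  push_cast
  rfl

theorem norm_sqrt_apply_sq {P : H →L[ℂ] H} {s : H → ℝ} (hs : ∀ x, ⟪x, P x⟫_ℂ = (s x : ℂ))
    (h0 : ∀ x, 0 ≤ s x) (x : H) : ‖CFC.sqrt P x‖ ^ 2 = s x := by
  have hP := nonneg_of_inner_eq hs h0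
  have hsa : IsSelfAdjoint (CFC.sqrt P) := (CFC.sqrt_nonneg P).isSelfAdjoint
  have h1 : ⟪CFC.sqrt P x, CFC.sqrt P x⟫_ℂ = ⟪x, P x⟫_ℂ := by
    have h2 := ContinuousLinearMap.adjoint_inner_right (CFC.sqrt P) x (CFC.sqrt P x)
    rw [← ContinuousLinearMap.star_eq_adjoint, hsa.star_eq] at h2
    rw [← h2]
    change ⟪x, (CFC.sqrt P * CFC.sqrt P) x⟫_ℂ = _
    rw [CFC.sqrt_mul_sqrt_self P hP]
  rw [hs, inner_self_eq_norm_sq_to_K] at h1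
  refine Complex.ofReal_injective ?_
  rw [Complex.ofReal_pow]
  exact h1

end QuadraticForm

namespace PosRegular

variable {n : ℕ} (f : PosRegular n)
  {H : Type*} [NormedAddCommGroup H] [InnerProductSpace ℂ H] [CompleteSpace H]

/-! ## The quadratic form of `Φ_{f,T}(I)` -/

/-- The operator `a_α T_α T_α*`. -/
def phiOp (T : Fin n → H →L[ℂ] H) (α : Word n) : H →L[ℂ] H :=
  (f.coeff α : ℂ) • (opWord T α * 1 * star (opWord T α))

theorem inner_phiOp (T : Fin n → H →L[ℂ] H) (α : Word n) (x : H) :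
    ⟪x, f.phiOp T α x⟫_ℂ = ((f.coeff α * ‖star (opWord T α) x‖ ^ 2 : ℝ) : ℂ) := by
  have h : f.phiOp T α x = (f.coeff α : ℂ) • opWord T α (star (opWord T α) x) := by
    unfold phiOp; rw [mul_one]; rfl
  rw [h, inner_smul_right, ← ContinuousLinearMap.adjoint_inner_left,
    ← ContinuousLinearMap.star_eq_adjoint, inner_self_eq_norm_sq_to_K]
  push_cast
  rfl

/-- The terms of the quadratic form of `Φ_{f,T}(I)`. -/
def formTerm (T : Fin n → H →L[ℂ] H) (x : H) (α : Word n) : ℝ :=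
  f.coeff α * ‖star (opWord T α) x‖ ^ 2

theorem formTerm_nonneg (T : Fin n → H →L[ℂ] H) (x : H) (α : Word n) : 0 ≤ f.formTerm T x α :=
  mul_nonneg (f.coeff_nonneg α) (by positivity)

variable {f} {T : Fin n → H →L[ℂ] H}

/-- Pairing with `x` on both sides is continuous for the weak operator topology, so the operator
series becomes a scalar series of nonnegative terms. -/
theorem hasSum_formTerm (hT : Summable (f.phiTerm T 1)) (x : H) :
    HasSum (f.formTerm T x) (∑' α, f.formTerm T x α) ∧
      ⟪x, f.Phi T 1 x⟫_ℂ = ((∑' α, f.formTerm T x α : ℝ) : ℂ) := by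
  have h1 : HasSum (fun α => ⟪x, f.phiOp T α x⟫_ℂ) ⟪x, f.Phi T 1 x⟫_ℂ := by
    let φ : (H →WOT[ℂ] H) →+ ℂ :=
      { toFun := fun A => innerSL ℂ x (A x)
        map_zero' := by simp
        map_add' := fun A B => inner_add_right x (A x) (B x) }
    exact hT.hasSum.map φ (ContinuousLinearMapWOT.continuous_dual_apply x (innerSL ℂ x))
  have h2 : HasSum (f.formTerm T x) (⟪x, f.Phi T 1 x⟫_ℂ).re := by
    have h3 := Complex.hasSum_re h1
    simp_rw [inner_phiOp, Complex.ofReal_re] at h3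
    exact h3
  have h4 : HasSum (f.formTerm T x) (∑' α, f.formTerm T x α) := h2.summable.hasSum
  refine ⟨h4, ?_⟩
  simp_rw [inner_phiOp] at h1
  exact h1.unique (Complex.hasSum_ofReal.mpr h4)

theorem tsum_formTerm_le (hT : T ∈ f.domain H) (x : H) : ∑' α, f.formTerm T x α ≤ ‖x‖ ^ 2 := by
  have h := (hasSum_formTerm hT.1 x).2
  have h1 : ‖⟪x, f.Phi T 1 x⟫_ℂ‖ ≤ ‖x‖ ^ 2 := by
    refine (norm_inner_le_norm _ _).trans ?_
    rw [sq]
    refine mul_le_mul_of_nonneg_left ?_ (norm_nonneg _)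
    exact (ContinuousLinearMap.le_of_opNorm_le _ hT.2 x).trans_eq (one_mul _)
  rw [h, Complex.norm_real] at h1
  exact (le_abs_self _).trans h1

theorem norm_defect_sq (hT : T ∈ f.domain H) (x : H) :
    ‖f.defect T x‖ ^ 2 = ‖x‖ ^ 2 - ∑' α, f.formTerm T x α := by
  refine norm_sqrt_apply_sq (s := fun x => ‖x‖ ^ 2 - ∑' α, f.formTerm T x α) (fun x => ?_)
    (fun x => sub_nonneg.mpr (tsum_formTerm_le hT x)) x
  rw [sub_apply, inner_sub_right, (hasSum_formTerm hT.1 x).2, one_apply_eq_self,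
    inner_self_eq_norm_sq_to_K]
  push_cast
  rfl

theorem ofReal_formTerm (x : H) (α : Word n) :
    ENNReal.ofReal (f.formTerm T x α) =
      ENNReal.ofReal (f.coeff α) * ‖star (opWord T α) x‖ₑ ^ 2 := by
  rw [formTerm, ENNReal.ofReal_mul (f.coeff_nonneg α), ENNReal.ofReal_pow (norm_nonneg _),
    ofReal_norm]

theorem tsum_ofReal_formTerm (hT : T ∈ f.domain H) (x : H) :
    ∑' α, ENNReal.ofReal (f.coeff α) * ‖star (opWord T α) x‖ₑ ^ 2 =
      ENNReal.ofReal (∑' α, f.formTerm T x α) := by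
  rw [ENNReal.ofReal_tsum_of_nonneg (f.formTerm_nonneg T x) (hasSum_formTerm hT.1 x).1.summable]
  simp_rw [ofReal_formTerm]

theorem enorm_defect_sq_add (hT : T ∈ f.domain H) (x : H) :
    ‖f.defect T x‖ₑ ^ 2 + ∑' α, ENNReal.ofReal (f.coeff α) * ‖star (opWord T α) x‖ₑ ^ 2 =
      ‖x‖ₑ ^ 2 := by
  rw [tsum_ofReal_formTerm hT, ← ofReal_norm, ← ofReal_norm,
    ← ENNReal.ofReal_pow (norm_nonneg _), ← ENNReal.ofReal_pow (norm_nonneg _),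
    ← ENNReal.ofReal_add (by positivity) (tsum_nonneg (f.formTerm_nonneg T x)),
    norm_defect_sq hT, sub_add_cancel]

/-! ## Radial scaling -/

theorem formTerm_smul (r : ℝ) (x : H) (α : Word n) :
    f.formTerm (fun i => (r : ℂ) • T i) x α = (r ^ 2) ^ α.length * f.formTerm T x α := by
  unfold formTerm
  rw [opWord_smul, star_smul, smul_apply, norm_smul, norm_star, norm_pow, Complex.norm_real,
    mul_pow, ← pow_mul, mul_comm α.length 2, pow_mul, Real.norm_eq_abs, sq_abs]
  ring

/-- A word of length `k` gains the factor `r^(2k)`, which is at most `r²` unless the word is empty,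
and there the coefficient is zero. -/
theorem formTerm_smul_le {r : ℝ} (hr : r ∈ Set.Ico (0 : ℝ) 1) (x : H) (α : Word n) :
    f.formTerm (fun i => (r : ℂ) • T i) x α ≤ r ^ 2 * f.formTerm T x α := by
  rw [formTerm_smul]
  by_cases h : α = 1
  · subst h
    simp [formTerm, f.coeff_one]
  · refine mul_le_mul_of_nonneg_right ?_ (f.formTerm_nonneg T x α)
    have h0 : α.length ≠ 0 := fun h' => h (FreeMonoid.length_eq_zero.mp h')
    exact pow_le_of_le_one (by positivity) (pow_le_one₀ hr.1 hr.2.le) h0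

/-- For `rT` the series converges even in norm: on words longer than `N` the form is at most
`r^(2N)` times that of `T`, and positivity turns this bound on forms into a bound on norms. -/
theorem summable_phiOp_smul (hT : T ∈ f.domain H) {r : ℝ} (hr : r ∈ Set.Ico (0 : ℝ) 1) :
    Summable (f.phiOp (fun i => (r : ℂ) • T i)) := by
  have hr2 : r ^ 2 < 1 := pow_lt_one₀ hr.1 hr.2 two_ne_zero
  rw [summable_iff_vanishing_norm]
  intro ε hε
  obtain ⟨N, hN⟩ := exists_pow_lt_of_lt_one hε hr2
  -- The alphabet is finite, so the words of length at most `N` can serve as the exceptional finite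
  -- set in the Cauchy criterion.
  have hfin : {α : Word n | α.length ≤ N}.Finite := List.finite_length_le (Fin n) N
  refine ⟨hfin.toFinset, fun t ht => lt_of_le_of_lt ?_ hN⟩
  refine norm_le_of_inner_eq (by positivity)
    (s := fun x => ∑ α ∈ t, f.formTerm (fun i => (r : ℂ) • T i) x α) (fun x => ?_)
    (fun x => Finset.sum_nonneg fun α _ => f.formTerm_nonneg _ x α) fun x => ?_
  · rw [sum_apply, inner_sum, Complex.ofReal_sum]
    exact Finset.sum_congr rfl fun α _ => f.inner_phiOp _ α x
  · calc ∑ α ∈ t, f.formTerm (fun i => (r : ℂ) • T i) x α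
        ≤ ∑ α ∈ t, (r ^ 2) ^ N * f.formTerm T x α := by
          refine Finset.sum_le_sum fun α hα => ?_
          rw [formTerm_smul]
          refine mul_le_mul_of_nonneg_right ?_ (f.formTerm_nonneg T x α)
          refine pow_le_pow_of_le_one (by positivity) hr2.le ?_
          by_contra hlt
          exact Finset.disjoint_left.mp ht hα (hfin.mem_toFinset.mpr (not_le.mp hlt).le)
      _ = (r ^ 2) ^ N * ∑ α ∈ t, f.formTerm T x α := by rw [Finset.mul_sum]
      _ ≤ (r ^ 2) ^ N * ‖x‖ ^ 2 := by
          refine mul_le_mul_of_nonneg_left ?_ (by positivity)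
          exact ((hasSum_formTerm hT.1 x).1.summable.sum_le_tsum t
            fun α _ => f.formTerm_nonneg T x α).trans (tsum_formTerm_le hT x)

theorem tsum_formTerm_smul_le (hT : T ∈ f.domain H) {r : ℝ} (hr : r ∈ Set.Ico (0 : ℝ) 1)
    (hs : Summable (f.phiTerm (fun i => (r : ℂ) • T i) 1)) (x : H) :
    ∑' α, f.formTerm (fun i => (r : ℂ) • T i) x α ≤ r ^ 2 * ‖x‖ ^ 2 :=
  calc _ ≤ ∑' α, r ^ 2 * f.formTerm T x α :=
        (hasSum_formTerm hs x).1.summable.tsum_le_tsum (fun α => formTerm_smul_le hr x α)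
          ((hasSum_formTerm hT.1 x).1.summable.mul_left _)
    _ = r ^ 2 * ∑' α, f.formTerm T x α := tsum_mul_left
    _ ≤ r ^ 2 * ‖x‖ ^ 2 := mul_le_mul_of_nonneg_left (tsum_formTerm_le hT x) (by positivity)

theorem smul_mem_domain (hT : T ∈ f.domain H) {r : ℝ} (hr : r ∈ Set.Ico (0 : ℝ) 1) :
    (fun i => (r : ℂ) • T i) ∈ f.domain H := by
  have hs : Summable (f.phiTerm (fun i => (r : ℂ) • T i) 1) :=
    (summable_phiOp_smul hT hr).map
      ({ toFun := ContinuousLinearMapWOT.ofCLM, map_zero' := rfl, map_add' := fun _ _ => rfl } :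
        (H →L[ℂ] H) →+ (H →WOT[ℂ] H)) ContinuousLinearMapWOT.continuous_ofCLM
  refine ⟨hs, norm_le_of_inner_eq zero_le_one (fun x => (hasSum_formTerm hs x).2)
    (fun x => tsum_nonneg (f.formTerm_nonneg _ x)) fun x => ?_⟩
  refine (tsum_formTerm_smul_le hT hr hs x).trans ?_
  exact mul_le_mul_of_nonneg_right (pow_le_one₀ hr.1 hr.2.le) (by positivity)

theorem bPairing_defect_smul (hT : T ∈ f.domain H) {r : ℝ} (hr : r ∈ Set.Ico (0 : ℝ) 1) (h : H) :
    f.bPairing (fun β => ‖f.defect (fun i => (r : ℂ) • T i)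
      (star (opWord (fun i => (r : ℂ) • T i) β) h)‖ₑ ^ 2) = ‖h‖ₑ ^ 2 := by
  have hrT := smul_mem_domain hT hr
  have hρ : ENNReal.ofReal (r ^ 2) < 1 :=
    ENNReal.ofReal_lt_one.mpr (pow_lt_one₀ hr.1 hr.2 two_ne_zero)
  refine f.bPairing_defect hρ (fun x => ?_) (enorm_defect_sq_add hrT) h
  rw [tsum_ofReal_formTerm hrT, ← ofReal_norm, ← ENNReal.ofReal_pow (norm_nonneg _),
    ← ENNReal.ofReal_mul (by positivity)]
  exact ENNReal.ofReal_le_ofReal (tsum_formTerm_smul_le hT hr hrT.1 x)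

end PosRegular

/-! ## The adjoint of an ampliation -/

section Adjoint

variable {E : Type*} [NormedAddCommGroup E] [InnerProductSpace ℂ E] [CompleteSpace E]
  {F : Type*} [NormedAddCommGroup F] [InnerProductSpace ℂ F]

theorem inner_rTensor_left (g : E →L[ℂ] E) (z w : E ⊗[ℂ] F) :
    ⟪g.rTensor F z, w⟫_ℂ = ⟪z, (star g).rTensor F w⟫_ℂ := by
  induction z using TensorProduct.induction_on with
  | zero => rw [map_zero, inner_zero_left, inner_zero_left]
  | add z₁ z₂ h₁ h₂ => rw [map_add, inner_add_left, inner_add_left, h₁, h₂]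
  | tmul x y =>
    induction w using TensorProduct.induction_on with
    | zero => rw [map_zero, inner_zero_right, inner_zero_right]
    | add w₁ w₂ h₁ h₂ => rw [map_add, inner_add_right, inner_add_right, h₁, h₂]
    | tmul x' y' =>
      rw [ContinuousLinearMap.rTensor_tmul, ContinuousLinearMap.rTensor_tmul,
        TensorProduct.inner_tmul, TensorProduct.inner_tmul, ContinuousLinearMap.star_eq_adjoint,
        ContinuousLinearMap.adjoint_inner_right]

theorem inner_ampliation_left (g : E →L[ℂ] E) (z w : HTensor E F) :
    ⟪ampliation F g z, w⟫_ℂ = ⟪z, ampliation F (star g) w⟫_ℂ := by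
  refine HTensor.denseRange_coe.induction_on₂ (p := fun z w : HTensor E F =>
    ⟪ampliation F g z, w⟫_ℂ = ⟪z, ampliation F (star g) w⟫_ℂ)
    (isClosed_eq (by fun_prop) (by fun_prop)) (fun z w => ?_) z w
  rw [ampliation_coe, ampliation_coe, UniformSpace.Completion.inner_coe,
    UniformSpace.Completion.inner_coe, inner_rTensor_left]

end Adjoint

/-! ## The weighted shifts on the Fock basis -/

open scoped Classical in
theorem fockBasis_eq_single (n : ℕ) (α : Word n) :
    fockBasis n α = lp.single 2 α (1 : ℂ) := by
  exact ((fockBasis n).repr_symm_single α).symm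

theorem fock_ext {n : ℕ} {x y : Fock n} (h : ∀ α, ⟪fockBasis n α, x⟫_ℂ = ⟪fockBasis n α, y⟫_ℂ) :
    x = y := by
  refine (fockBasis n).repr.injective (lp.ext (funext fun α => ?_))
  rw [HilbertBasis.repr_apply_apply, HilbertBasis.repr_apply_apply, h]

open scoped Classical in
theorem inner_fockBasis (n : ℕ) (α β : Word n) :
    ⟪fockBasis n α, fockBasis n β⟫_ℂ = if α = β then 1 else 0 :=
  orthonormal_iff_ite.mp (fockBasis n).orthonormal α β

namespace PosRegular

variable {n : ℕ} (f : PosRegular n)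

theorem creation_fockBasis (i : Fin n) (α : Word n) :
    creation i (fockBasis n α) = fockBasis n (FreeMonoid.of i * α) := by
  classical
  rw [fockBasis_eq_single n α, creation]
  refine (OrthogonalFamily.linearIsometry_apply_single (G := fun _ : Word n => ℂ) _ (1 : ℂ)).trans ?_
  simp

theorem diag_fockBasis (i : Fin n) (α : Word n) :
    f.diag i (fockBasis n α) =
      ((Real.sqrt (f.b α / f.b (FreeMonoid.of i * α)) : ℝ) : ℂ) • fockBasis n α := by
  classical
  rw [fockBasis_eq_single]
  refine lp.ext (funext fun β => ?_)
  change ((Real.sqrt (f.b β / f.b (FreeMonoid.of i * β)) : ℝ) : ℂ) •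
    (lp.single 2 α (1 : ℂ) : Fock n) β =
      ((Real.sqrt (f.b α / f.b (FreeMonoid.of i * α)) : ℝ) : ℂ) • (lp.single 2 α (1 : ℂ) : Fock n) β
  by_cases h : β = α
  · subst h; rfl
  · have h0 : (lp.single 2 α (1 : ℂ) : Fock n) β = 0 :=
      lp.single_apply_ne (E := fun _ : Word n => ℂ) 2 α (1 : ℂ) h
    exact (congrArg _ h0).trans ((smul_zero _).trans
      ((smul_zero _).symm.trans (congrArg _ h0.symm)))

theorem W_fockBasis (i : Fin n) (α : Word n) :
    f.W i (fockBasis n α) = ((Real.sqrt (f.b α / f.b (FreeMonoid.of i * α)) : ℝ) : ℂ) •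
      fockBasis n (FreeMonoid.of i * α) := by
  change creation i (f.diag i (fockBasis n α)) = _
  rw [diag_fockBasis, map_smul, creation_fockBasis]

open scoped Classical in
theorem inner_star_W (i : Fin n) (α β : Word n) :
    ⟪fockBasis n α, star (f.W i) (fockBasis n β)⟫_ℂ =
      if FreeMonoid.of i * α = β then
        ((Real.sqrt (f.b α / f.b (FreeMonoid.of i * α)) : ℝ) : ℂ) else 0 := by
  rw [ContinuousLinearMap.star_eq_adjoint, ContinuousLinearMap.adjoint_inner_right, W_fockBasis,
    inner_smul_left, Complex.conj_ofReal, inner_fockBasis, mul_ite, mul_one, mul_zero]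

theorem star_W_fockBasis_mul (i : Fin n) (α : Word n) :
    star (f.W i) (fockBasis n (FreeMonoid.of i * α)) =
      ((Real.sqrt (f.b α / f.b (FreeMonoid.of i * α)) : ℝ) : ℂ) • fockBasis n α := by
  refine fock_ext fun β => ?_
  rw [inner_star_W, inner_smul_right, inner_fockBasis, mul_ite, mul_one, mul_zero]
  by_cases h : β = α
  · subst h; rw [if_pos rfl, if_pos rfl]
  · rw [if_neg h, if_neg fun h' => h (mul_left_cancel h')]

theorem star_W_fockBasis_of_notMem (i : Fin n) (β : Word n)
    (h : β ∉ Set.range fun α : Word n => FreeMonoid.of i * α) :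
    star (f.W i) (fockBasis n β) = 0 := by
  refine fock_ext fun α => ?_
  rw [inner_star_W, inner_zero_right, if_neg fun h' => h ⟨α, h'⟩]

/-! ## Poisson kernels -/

variable {f} {H : Type*} [NormedAddCommGroup H] [InnerProductSpace ℂ H]

/-- The isometric embedding `h ↦ e_α ⊗ h`. -/
def basisTensor (H : Type*) [NormedAddCommGroup H] [InnerProductSpace ℂ H] {n : ℕ} (α : Word n) :
    H →ₗᵢ[ℂ] HTensor (Fock n) H where
  toLinearMap := (UniformSpace.Completion.toComplL :
      (Fock n ⊗[ℂ] H) →L[ℂ] HTensor (Fock n) H).toLinearMap.comp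
    (TensorProduct.mk ℂ (Fock n) H (fockBasis n α))
  norm_map' h := by
    change ‖((fockBasis n α ⊗ₜ[ℂ] h : Fock n ⊗[ℂ] H) : HTensor (Fock n) H)‖ = ‖h‖
    rw [UniformSpace.Completion.norm_coe, TensorProduct.norm_tmul,
      (fockBasis n).orthonormal.norm_eq_one, one_mul]

theorem basisTensor_apply (α : Word n) (h : H) :
    basisTensor H α h = ((fockBasis n α ⊗ₜ[ℂ] h : Fock n ⊗[ℂ] H) : HTensor (Fock n) H) := rfl

theorem orthogonalFamily_basisTensor :
    OrthogonalFamily ℂ (fun _ : Word n => H) (fun α => basisTensor H α) := by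
  intro α β hαβ x y
  rw [basisTensor_apply, basisTensor_apply, UniformSpace.Completion.inner_coe,
    TensorProduct.inner_tmul, inner_fockBasis, if_neg hαβ, zero_mul]

variable [CompleteSpace H]

/-- The summands lie in the mutually orthogonal copies `e_α ⊗ H`, and their squared norms add up to
`‖h‖²` by hypothesis. Hence the series converges and its sum depends isometrically on `h`. -/
theorem exists_isPoissonKernel {T : Fin n → H →L[ℂ] H}
    (hT : ∀ h, f.bPairing (fun β => ‖f.defect T (star (opWord T β) h)‖ₑ ^ 2) = ‖h‖ₑ ^ 2) :
    ∃ K : H →ₗᵢ[ℂ] HTensor (Fock n) H, f.IsPoissonKernel T K.toContinuousLinearMap := by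
  let v : Word n → H →L[ℂ] H := fun α =>
    ((Real.sqrt (f.b α) : ℝ) : ℂ) • (f.defect T).comp (star (opWord T α))
  have hv : ∀ α h, ‖v α h‖ ^ 2 = f.b α * ‖f.defect T (star (opWord T α) h)‖ ^ 2 := by
    intro α h
    change ‖((Real.sqrt (f.b α) : ℝ) : ℂ) • f.defect T (star (opWord T α) h)‖ ^ 2 = _
    rw [norm_smul, mul_pow, Complex.norm_real, Real.norm_eq_abs, sq_abs,
      Real.sq_sqrt (f.b_pos α).le]
  have hsum : ∀ h, HasSum (fun α => ‖v α h‖ ^ 2) (‖h‖ ^ 2) := by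
    intro h
    have h1 : ∑' α, ENNReal.ofReal (‖v α h‖ ^ 2) = ENNReal.ofReal (‖h‖ ^ 2) := by
      rw [ENNReal.ofReal_pow (norm_nonneg _), ofReal_norm, ← hT h]
      refine tsum_congr fun α => ?_
      rw [hv, ENNReal.ofReal_mul (f.b_pos α).le, ENNReal.ofReal_pow (norm_nonneg _), ofReal_norm]
    have h2 := ENNReal.hasSum_toReal (f := fun α => ENNReal.ofReal (‖v α h‖ ^ 2))
      (by rw [h1]; exact ENNReal.ofReal_ne_top)
    rw [← ENNReal.tsum_toReal_eq fun _ => ENNReal.ofReal_ne_top, h1] at h2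
    simpa only [ENNReal.toReal_ofReal (sq_nonneg _)] using h2
  have hV := orthogonalFamily_basisTensor (n := n) (H := H)
  have hsumm : ∀ h, Summable fun α => basisTensor H α (v α h) := fun h =>
    (hV.summable_iff_norm_sq_summable _).mpr (hsum h).summable
  let K : H →ₗᵢ[ℂ] HTensor (Fock n) H :=
    { toFun := fun h => ∑' α, basisTensor H α (v α h)
      map_add' := fun x y => by
        simp only [map_add]
        exact (hsumm x).tsum_add (hsumm y)
      map_smul' := fun c x => by
        simp only [map_smul, RingHom.id_apply]
        exact (hsumm x).tsum_const_smul c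
      norm_map' := fun h => by
        refine (sq_eq_sq₀ (norm_nonneg _) (norm_nonneg _)).mp ?_
        refine tendsto_nhds_unique ?_ (hsum h)
        convert ((hsumm h).hasSum.norm.pow 2) using 1
        · exact funext fun s => (hV.norm_sum (fun α => v α h) s).symm
        · rfl }
  refine ⟨K, fun h => ?_⟩
  change HasSum _ (∑' α, basisTensor H α (v α h))
  convert (hsumm h).hasSum using 1
  refine funext fun α => ?_
  change _ = basisTensor H α (((Real.sqrt (f.b α) : ℝ) : ℂ) • f.defect T (star (opWord T α) h))
  rw [map_smul, basisTensor_apply]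

/-- `W_i*` removes a leading `g_i`, and its weight `√(b_α / b_{g_i α})` turns the coefficient
`√b_{g_i α}` of the kernel into `√b_α`. -/
theorem IsPoissonKernel.ampliation_star_W {T : Fin n → H →L[ℂ] H}
    {K : H →L[ℂ] HTensor (Fock n) H} (hK : f.IsPoissonKernel T K) (i : Fin n) (h : H) :
    ampliation H (star (f.W i)) (K h) = K (star (T i) h) := by
  have h1 := (hK h).mapL (ampliation H (star (f.W i)))
  have hinj : Function.Injective fun α : Word n => FreeMonoid.of i * α :=
    mul_right_injective (FreeMonoid.of i)
  -- Only words beginning with `g_i` survive `W_i*`, so the sum is reindexed by the remaining part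
  -- of the word.
  rw [← hinj.hasSum_iff] at h1
  · refine h1.unique ?_
    convert hK (star (T i) h) using 1
    refine funext fun α => ?_
    have hb : Real.sqrt (f.b (FreeMonoid.of i * α)) *
        Real.sqrt (f.b α / f.b (FreeMonoid.of i * α)) = Real.sqrt (f.b α) := by
      rw [← Real.sqrt_mul (f.b_pos _).le, mul_div_cancel₀ _ (f.b_pos _).ne']
    rw [Function.comp_apply, map_smul, ampliation_coe_tmul, star_W_fockBasis_mul,
      ← TensorProduct.smul_tmul', UniformSpace.Completion.coe_smul, smul_smul,
      ← Complex.ofReal_mul, hb, star_opWord_mul_apply, opWord_of]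
  · intro β hβ
    rw [map_smul, ampliation_coe_tmul, f.star_W_fockBasis_of_notMem i β hβ,
      TensorProduct.zero_tmul, UniformSpace.Completion.coe_zero, smul_zero]

theorem IsPoissonKernel.ampliation_star_opWord {T : Fin n → H →L[ℂ] H}
    {K : H →L[ℂ] HTensor (Fock n) H} (hK : f.IsPoissonKernel T K) (α : Word n) (h : H) :
    ampliation H (star (opWord f.W α)) (K h) = K (star (opWord T α) h) := by
  induction α using FreeMonoid.inductionOn' generalizing h with
  | one =>
    rw [opWord_one, opWord_one, star_one, star_one, ampliation_one]; rfl
  | of_mul i α ih =>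
    rw [opWord_mul, star_mul, ampliation_mul, mul_apply_eq_comp, opWord_of,
      hK.ampliation_star_W, ih, star_opWord_mul_apply, opWord_of]

/-- In the sesquilinear form, `W_α` moves to the other side as `W_α*`. The intertwining relation
then applies in both slots, and the isometry `K` drops out of the inner product. -/
theorem IsPoissonKernel.compression_opWord {T : Fin n → H →L[ℂ] H}
    {K : H →ₗᵢ[ℂ] HTensor (Fock n) H} (hK : f.IsPoissonKernel T K.toContinuousLinearMap)
    (α β : Word n) :
    compression K.toContinuousLinearMap (opWord f.W α * star (opWord f.W β)) =
      opWord T α * star (opWord T β) := by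
  refine ContinuousLinearMap.ext fun h => ext_inner_right ℂ fun k => ?_
  change ⟪ContinuousLinearMap.adjoint K.toContinuousLinearMap
    (ampliation H (opWord f.W α * star (opWord f.W β)) (K.toContinuousLinearMap h)), k⟫_ℂ = _
  rw [ContinuousLinearMap.adjoint_inner_left, ampliation_mul, mul_apply_eq_comp,
    hK.ampliation_star_opWord, inner_ampliation_left, hK.ampliation_star_opWord]
  change ⟪K _, K _⟫_ℂ = _
  rw [K.inner_map_map, ContinuousLinearMap.star_eq_adjoint (opWord T α),
    ContinuousLinearMap.adjoint_inner_right]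
  rfl

end PosRegular

/-! ## Limits of contractive families of linear maps -/

theorem exists_tendsto_of_mem_span {ι E G : Type*} [NormedAddCommGroup E] [NormedSpace ℂ E]
    [NormedAddCommGroup G] [NormedSpace ℂ G] {l : Filter ι} {φ : ι → E →ₗ[ℂ] G} {s : Set E}
    (hs : ∀ g ∈ s, ∃ L, Tendsto (fun t => φ t g) l (𝓝 L)) {g : E}
    (hg : g ∈ Submodule.span ℂ s) : ∃ L, Tendsto (fun t => φ t g) l (𝓝 L) := by
  induction hg using Submodule.span_induction with
  | mem x hx => exact hs x hx
  | zero => exact ⟨0, by simp only [map_zero]; exact tendsto_const_nhds⟩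
  | add x y _ _ hx hy =>
    obtain ⟨L₁, h₁⟩ := hx
    obtain ⟨L₂, h₂⟩ := hy
    exact ⟨L₁ + L₂, by simpa only [map_add] using h₁.add h₂⟩
  | smul c x _ hx =>
    obtain ⟨L, h⟩ := hx
    exact ⟨c • L, by simpa only [map_smul] using h.const_smul c⟩

/-- An `ε/3` argument: the uniform contraction bound transfers the Cauchy property from a nearby
element of `M`, and `G` is complete. -/
theorem exists_tendsto_of_mem_topologicalClosure {ι E G : Type*} [NormedAddCommGroup E]
    [NormedSpace ℂ E] [NormedAddCommGroup G] [NormedSpace ℂ G] [CompleteSpace G] {l : Filter ι}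
    [l.NeBot] {φ : ι → E →ₗ[ℂ] G} (hφ : ∀ t g, ‖φ t g‖ ≤ ‖g‖) {M : Submodule ℂ E}
    (hM : ∀ g ∈ M, ∃ L, Tendsto (fun t => φ t g) l (𝓝 L)) {g : E}
    (hg : g ∈ M.topologicalClosure) : ∃ L, Tendsto (fun t => φ t g) l (𝓝 L) := by
  rw [← cauchy_map_iff_exists_tendsto, Metric.cauchy_iff]
  refine ⟨inferInstance, fun ε hε => ?_⟩
  obtain ⟨p, hp, hgp⟩ := Metric.mem_closure_iff.mp hg (ε / 3) (by positivity)
  obtain ⟨L, hL⟩ := hM p hp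
  obtain ⟨t, ht, hd⟩ := (Metric.cauchy_iff.mp hL.cauchy_map).2 (ε / 3) (by positivity)
  refine ⟨(fun r => φ r g) '' ((fun r => φ r p) ⁻¹' t), image_mem_map ht, ?_⟩
  rintro _ ⟨r, hr, rfl⟩ _ ⟨r', hr', rfl⟩
  have key : ∀ t, dist (φ t g) (φ t p) < ε / 3 := fun t => by
    rw [dist_eq_norm, ← map_sub]
    exact (hφ t _).trans_lt (by rwa [← dist_eq_norm])
  have h3 := key r'
  rw [dist_comm] at h3
  calc dist (φ r g) (φ r' g)
      ≤ dist (φ r g) (φ r p) + dist (φ r p) (φ r' p) + dist (φ r' p) (φ r' g) :=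
        dist_triangle4 _ _ _ _
    _ < ε / 3 + ε / 3 + ε / 3 := add_lt_add (add_lt_add (key r) (hd _ hr _ hr')) h3
    _ = ε := by ring

/-- The pointwise limit of linear maps, as a linear map. -/
theorem exists_linearMap_tendsto {ι E G : Type*} [AddCommGroup E] [Module ℂ E]
    [NormedAddCommGroup G] [NormedSpace ℂ G] {l : Filter ι} [l.NeBot] {φ : ι → E →ₗ[ℂ] G}
    (h : ∀ g, ∃ L, Tendsto (fun t => φ t g) l (𝓝 L)) :
    ∃ Ψ : E →ₗ[ℂ] G, ∀ g, Tendsto (fun t => φ t g) l (𝓝 (Ψ g)) := by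
  choose Ψ hΨ using h
  refine ⟨{ toFun := Ψ, map_add' := fun x y => ?_, map_smul' := fun c x => ?_ }, hΨ⟩
  · refine tendsto_nhds_unique (hΨ (x + y)) ?_
    simpa only [map_add] using (hΨ x).add (hΨ y)
  · refine tendsto_nhds_unique (hΨ (c • x)) ?_
    simpa only [map_smul, RingHom.id_apply] using (hΨ x).const_smul c

/-! ## Polynomials in noncommuting indeterminates -/

/-- Expanding a polynomial into words makes its inequality the case `β = 1` of the one for `∑
c_{α,β} T_α T_β*`. -/
theorem freeAlgebra_lift_eq_sum {n : ℕ} {H : Type*} [NormedAddCommGroup H]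
    [InnerProductSpace ℂ H] (X : Fin n → H →L[ℂ] H) (q : FreeAlgebra ℂ (Fin n)) :
    FreeAlgebra.lift ℂ X q =
      ∑ α ∈ (FreeAlgebra.equivMonoidAlgebraFreeMonoid q).coeff.support,
        (FreeAlgebra.equivMonoidAlgebraFreeMonoid q).coeff α • opWord X α := by
  have h : FreeAlgebra.lift ℂ X = (MonoidAlgebra.lift ℂ (H →L[ℂ] H) (FreeMonoid (Fin n))
      (FreeMonoid.lift X)).comp
      (FreeAlgebra.equivMonoidAlgebraFreeMonoid (R := ℂ) (X := Fin n)).toAlgHom := by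
    refine FreeAlgebra.hom_ext (funext fun i => ?_)
    simp [FreeAlgebra.equivMonoidAlgebraFreeMonoid]
  rw [h]
  exact MonoidAlgebra.lift_apply _ _

end NCDomain

end

/-! ### The Poisson transform and the von Neumann inequality -/

theorem mainTheorem3 {n : ℕ} [NeZero n] (f : NCDomain.PosRegular n)
    {H : Type*} [NormedAddCommGroup H] [InnerProductSpace ℂ H] [CompleteSpace H]
    (T : Fin n → H →L[ℂ] H) (hT : T ∈ f.domain H) :
    ∃ K : ℝ → (H →L[ℂ] NCDomain.HTensor (NCDomain.Fock n) H),
      (∀ r ∈ Set.Ico (0 : ℝ) 1,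
        (fun i => (r : ℂ) • T i) ∈ f.domain H ∧
          f.IsPoissonKernel (fun i => (r : ℂ) • T i) (K r)) ∧
      ∃ Ψ : f.poissonSpace →ₗ[ℂ] (H →L[ℂ] H),
        Ψ ⟨1, f.one_mem_poissonSpace⟩ = 1 ∧
        NCDomain.IsCompletelyContractive f.poissonSpace Ψ ∧
        (∀ α β : NCDomain.Word n,
          Ψ ⟨NCDomain.opWord f.W α * star (NCDomain.opWord f.W β), f.mem_poissonSpace α β⟩ =
            NCDomain.opWord T α * star (NCDomain.opWord T β)) ∧
        (∀ g : f.poissonSpace,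
          Tendsto
            (fun r : ℝ => (ContinuousLinearMap.adjoint (K r)).comp
              ((NCDomain.ampliation H (g : NCDomain.Fock n →L[ℂ] NCDomain.Fock n)).comp (K r)))
            (𝓝[<] 1) (𝓝 (Ψ g))) ∧
        (∀ c : NCDomain.Word n × NCDomain.Word n →₀ ℂ,
          ‖c.sum fun p z => z • (NCDomain.opWord T p.1 * star (NCDomain.opWord T p.2))‖ ≤
            ‖c.sum fun p z => z • (NCDomain.opWord f.W p.1 * star (NCDomain.opWord f.W p.2))‖) ∧
        (∀ q : FreeAlgebra ℂ (Fin n),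
          ‖FreeAlgebra.lift ℂ T q‖ ≤ ‖FreeAlgebra.lift ℂ f.W q‖) := by
  open NCDomain in
  classical
  have hK : ∀ r : ℝ, ∃ K : H →L[ℂ] HTensor (Fock n) H, ‖K‖ ≤ 1 ∧ (r ∈ Set.Ico (0 : ℝ) 1 →
      f.IsPoissonKernel (fun i => (r : ℂ) • T i) K ∧
      ∀ α β : Word n, compression K (opWord f.W α * star (opWord f.W β)) =
        (r : ℂ) ^ (α.length + β.length) • (opWord T α * star (opWord T β))) := by
    intro r
    by_cases hr : r ∈ Set.Ico (0 : ℝ) 1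
    · obtain ⟨K, hK⟩ := PosRegular.exists_isPoissonKernel (PosRegular.bPairing_defect_smul hT hr)
      refine ⟨K.toContinuousLinearMap, K.norm_toContinuousLinearMap_le, fun _ => ⟨hK, ?_⟩⟩
      intro α β
      rw [hK.compression_opWord, opWord_smul, opWord_smul, star_smul, smul_mul_smul_comm,
        pow_add, star_pow, Complex.star_def, Complex.conj_ofReal]
    -- Outside `[0, 1)` the kernel is set to zero. This does not affect the limit `r → 1⁻`, and it
    -- keeps `‖K r‖ ≤ 1` for every real `r`, as the limit lemmas require.
    · exact ⟨0, ContinuousLinearMap.opNorm_zero.trans_le zero_le_one, fun h => absurd h hr⟩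
  choose K hK1 hK2 using hK
  have hnear : ∀ᶠ r : ℝ in 𝓝[<] 1, r ∈ Set.Ico (0 : ℝ) 1 :=
    Ico_mem_nhdsLT zero_lt_one
  have hword : ∀ α β : Word n, Tendsto
      (fun r : ℝ => compression (K r) (opWord f.W α * star (opWord f.W β))) (𝓝[<] 1)
      (𝓝 (opWord T α * star (opWord T β))) := by
    intro α β
    have hc : Continuous fun r : ℝ =>
        (r : ℂ) ^ (α.length + β.length) • (opWord T α * star (opWord T β)) := by fun_prop
    have h1 := (hc.tendsto 1).mono_left (nhdsWithin_le_nhds (s := Set.Iio 1))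
    rw [Complex.ofReal_one, one_pow, one_smul] at h1
    -- The compression equals `r^(|α|+|β|) T_α T_β*` only for `r` in `[0, 1)`, which is eventually
    -- the case.
    exact h1.congr' (hnear.mono fun r hr => ((hK2 r hr).2 α β).symm)
  have hlim : ∀ g : f.poissonSpace, ∃ L, Tendsto (fun r : ℝ =>
      ((compression (K r)).comp f.poissonSpace.subtype) g) (𝓝[<] 1) (𝓝 L) := fun g =>
    exists_tendsto_of_mem_topologicalClosure (φ := fun r : ℝ => compression (K r))
      (fun r g => compression_norm_le (hK1 r) g)
      (fun p hp => exists_tendsto_of_mem_span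
        (by rintro _ ⟨⟨α, β⟩, rfl⟩; exact ⟨_, hword α β⟩) hp) g.2
  obtain ⟨Ψ, hΨ⟩ := exists_linearMap_tendsto hlim
  have hΨword : ∀ α β : Word n,
      Ψ ⟨opWord f.W α * star (opWord f.W β), f.mem_poissonSpace α β⟩ =
        opWord T α * star (opWord T β) := fun α β =>
    tendsto_nhds_unique (hΨ _) (hword α β)
  have hΨone : Ψ ⟨1, f.one_mem_poissonSpace⟩ = 1 := by
    have h := hΨword 1 1
    simpa only [opWord_one, star_one, mul_one] using h
  have hΨnorm : ∀ g, ‖Ψ g‖ ≤ ‖(g : Fock n →L[ℂ] Fock n)‖ := fun g =>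
    le_of_tendsto (hΨ g).norm (Eventually.of_forall fun r => compression_norm_le (hK1 r) _)
  have hsum : ∀ (s : Finset (Word n × Word n)) (c : Word n × Word n → ℂ),
      ‖∑ p ∈ s, c p • (opWord T p.1 * star (opWord T p.2))‖ ≤
        ‖∑ p ∈ s, c p • (opWord f.W p.1 * star (opWord f.W p.2))‖ := by
    intro s c
    have h := hΨnorm (∑ p ∈ s, c p •
      (⟨opWord f.W p.1 * star (opWord f.W p.2), f.mem_poissonSpace p.1 p.2⟩ : f.poissonSpace))
    simpa only [map_sum, map_smul, hΨword, Submodule.coe_sum, Submodule.coe_smul] using h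
  refine ⟨K, fun r hr => ⟨PosRegular.smul_mem_domain hT hr, (hK2 r hr).1⟩, Ψ, hΨone, ?_, hΨword,
    hΨ, fun c => hsum c.support c, fun q => ?_⟩
  · intro m x
    -- Each compression satisfies the matrix bound with the same right-hand side, so the entrywise
    -- limit `Ψ` inherits it.
    refine opMatrix_norm_le_of_tendsto (ContinuousLinearMap.opNorm_nonneg _)
      (A := fun r : ℝ => (x.map fun s => (s : Fock n →L[ℂ] Fock n)).map (compression (K r)))
      (fun r => opMatrix_compression_norm_le (hK1 r) _) fun i j => hΨ (x i j)
  · rw [freeAlgebra_lift_eq_sum, freeAlgebra_lift_eq_sum]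
    -- The support of `q` is embedded by `α ↦ (α, 1)`, so that `W_β* = I` in every term.
    have h := hsum ((FreeAlgebra.equivMonoidAlgebraFreeMonoid q).coeff.support.map
      ⟨fun α => (α, 1), Prod.mk_left_injective 1⟩)
      (fun p => (FreeAlgebra.equivMonoidAlgebraFreeMonoid q).coeff p.1)
    simpa only [Finset.sum_map, Function.Embedding.coeFn_mk, opWord_one, star_one,
      mul_one] using h
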